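/- For $n\ge 0$ let $X_n=\{1,\dots,n\}$ with its natural total order $\le_n$ (so $X_0=\varnothing$). A semilattice on $X_n$ is a partial order $\preceq$ on $X_n$ in which every pair $x,y$ has a supremum $x\curlyvee y$. It is called nondecreasing for $\le_n$ if for all $a,b,c\in X_n$: (i) $a\le_n b\le_n c$ implies $b\preceq a\curlyvee c$, and (ii) $a<_n b<_n c$ implies $a\ne b\curlyvee c$ and $c\ne a\curlyvee b$. Let $\tau(n)$ be the number of isomorphism types of semilattices on $X_n$ that are nondecreasing for $\le_n$, where $(X_n,\preceq)$ and $(X_n,\preceq')$ have the same isomorphism type if there is a bijection $f\colon X_n\to X_n$ with $x\preceq y\iff f(x)\preceq' f(y)$ for all $x,y\in X_n$. Then $\tau(0)=\tau(1)=1$, and for all $n\ge 1$, $$\tau(2n)=\sum_{i=0}^{n-1}\tau(i)\,\tau(2n-1-i),$$ $$\tau(2n+1)=\sum_{i=0}^{n-1}\tau(i)\,\tau(2n-i)+\frac{\tau(n)}{2}\bigl(\tau(n)+1\bigr).$$ -/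

import Mathlib

/-! A semilattice on `X` is a join-semilattice order on `X`, bundled with its join operation, that is,
a term `S : SemilatticeSup X`. The chain `X_n` is `Fin n` with its natural order. As the two orders
live on the same type, they are written `S.le` (the semilattice order) and `L.le`, `L.lt` (the total
order), and `S.sup` is the join operation of the semilattice. -/

/-- The convex-ideal property: `a ≤ b ≤ c` implies that `b` is below the join of `a` and `c`. -/
def HasCIProperty {X : Type*} [L : LinearOrder X] (S : SemilatticeSup X) : Prop :=
  ∀ a b c : X, L.le a b → L.le b c → S.le b (S.sup a c)

/-- Internality: `a < b < c` implies that `a` is not the join of `b` and `c`, and `c` is not the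
join of `a` and `b`. -/
def IsInternalFor {X : Type*} [L : LinearOrder X] (S : SemilatticeSup X) : Prop :=
  ∀ a b c : X, L.lt a b → L.lt b c → a ≠ S.sup b c ∧ c ≠ S.sup a b

/-- A semilattice is nondecreasing for a total order if it has the convex-ideal property and is
internal for that order. -/
def IsNondecreasingFor {X : Type*} [LinearOrder X] (S : SemilatticeSup X) : Prop :=
  HasCIProperty S ∧ IsInternalFor S

/-- Two semilattices are isomorphic if there is an order isomorphism between their orders. -/
def SemilatticesIsomorphic {X Y : Type*} (S : SemilatticeSup X) (T : SemilatticeSup Y) : Prop :=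
  Nonempty (X ≃o Y)

/-- The semilattices on the chain with `n` elements that are nondecreasing for its order. -/
def NondecSemilattice (n : ℕ) : Type :=
  {S : SemilatticeSup (Fin n) // IsNondecreasingFor S}

/-- Isomorphism of semilattices (the total order of the chain need not be preserved). -/
def nondecSemilatticeSetoid (n : ℕ) : Setoid (NondecSemilattice n) where
  r S T := SemilatticesIsomorphic S.1 T.1
  iseqv :=
    { refl := fun S => ⟨@OrderIso.refl _ S.1.toLE⟩
      symm := fun {S T} h => h.elim fun e => ⟨@OrderIso.symm _ _ S.1.toLE T.1.toLE e⟩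
      trans := fun {S T U} h h' => h.elim fun e => h'.elim fun e' =>
        ⟨@OrderIso.trans _ _ _ S.1.toLE T.1.toLE U.1.toLE e e'⟩ }

/-- The number of isomorphism types of semilattices that are nondecreasing for the chain with `n`
elements. -/
noncomputable def numTypes (n : ℕ) : ℕ :=
  Nat.card (Quotient (nondecSemilatticeSetoid n))

/-! A finite nonempty semilattice has a top `t`, which splits the chain into the elements before `t`
and the elements after `t`. If the semilattice is nondecreasing, the convex-ideal property and
internality together make each part closed under joins: a join of elements of one part that leaves
it is above `t`, hence equal to `t`, which internality forbids. The convex-ideal property also makes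
the join of elements from different parts equal to `t`. So the semilattice is the disjoint union of two smaller nondecreasing semilattices with a top
added (`NondecSemilattice.exists_orderIso_glue`), and conversely any two nondecreasing semilattices
can be glued in this way (`NondecSemilattice.exists_glue`).

The order alone determines the two parts up to swapping them: they are the connected components of
the complement of the top, each being connected because it is a semilattice
(`nonempty_orderIso_or_of_sum`). Hence the isomorphism types with `N` elements correspond to the
unordered pairs of isomorphism types with `N - 1` elements in total. Listing the smaller part first,
these are counted by the sum over the size `i` of the smaller part, plus, for `N = 2 * n + 1`, the
number of unordered pairs of isomorphism types with `n` elements each. -/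

/-! ### Nondecreasing labellings -/

namespace NondecSemilattice

variable {n : ℕ}

/-- The underlying set of a nondecreasing semilattice, as a synonym of `Fin n` that carries the
semilattice order in place of the order of the chain. -/
def Carrier (_S : NondecSemilattice n) : Type := Fin n

instance (S : NondecSemilattice n) : SemilatticeSup S.Carrier := S.1

instance (S : NondecSemilattice n) : Fintype S.Carrier := inferInstanceAs (Fintype (Fin n))

/-- The position of an element in the chain. -/
def pos (S : NondecSemilattice n) (x : S.Carrier) : ℕ := Fin.val (n := n) x

theorem pos_injective (S : NondecSemilattice n) : Function.Injective S.pos :=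
  Fin.val_injective

theorem pos_lt (S : NondecSemilattice n) (x : S.Carrier) : S.pos x < n := Fin.isLt (n := n) x

theorem card_carrier (S : NondecSemilattice n) : Fintype.card S.Carrier = n := Fintype.card_fin n

end NondecSemilattice

/-- The label function `e` lists the elements of the semilattice `P` in an order for which `P` is
nondecreasing. -/
structure IsNondecLabelling {P : Type*} [SemilatticeSup P] (e : P → ℕ) : Prop where
  injective : Function.Injective e
  le_sup : ∀ a b c, e a ≤ e b → e b ≤ e c → b ≤ a ⊔ c
  ne_sup_right : ∀ a b c, e a < e b → e b < e c → a ≠ b ⊔ c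
  ne_sup_left : ∀ a b c, e a < e b → e b < e c → c ≠ a ⊔ b

theorem NondecSemilattice.isNondecLabelling_pos {n : ℕ} (S : NondecSemilattice n) :
    IsNondecLabelling S.pos where
  injective := S.pos_injective
  le_sup := S.2.1
  ne_sup_right a b c hab hbc := (S.2.2 a b c hab hbc).1
  ne_sup_left a b c hab hbc := (S.2.2 a b c hab hbc).2

/-- Replacing labels by their ranks: a labelled semilattice with `n` elements lives on the chain
with `n` elements. -/
theorem IsNondecLabelling.exists_orderIso {P : Type*} [S : SemilatticeSup P] [Fintype P]
    {e : P → ℕ} (he : IsNondecLabelling e) {n : ℕ} (hn : Fintype.card P = n) :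
    ∃ T : NondecSemilattice n, Nonempty (T.Carrier ≃o P) := by
  obtain ⟨g, hg⟩ : ∃ g : Fin n ≃ P, ∀ i j, e (g i) ≤ e (g j) ↔ i ≤ j := by
    let L : LinearOrder P := LinearOrder.lift' e he.injective
    let g : @OrderIso (Fin n) P _ L.toLE := @Fintype.orderIsoFinOfCardEq P L _ n hn
    exact ⟨g.toEquiv, fun i j => g.map_rel_iff⟩
  have hg' : ∀ i j, e (g i) < e (g j) ↔ i < j := fun i j => by
    simpa using not_congr (hg j i)
  let T : SemilatticeSup (Fin n) :=
    { le := fun i j => g i ≤ g j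
      lt := fun i j => g i < g j
      lt_iff_le_not_ge := fun i j => lt_iff_le_not_ge
      le_refl := fun i => le_refl (g i)
      le_trans := fun i j k => le_trans (a := g i)
      le_antisymm := fun i j h h' => g.injective (le_antisymm h h')
      sup := fun i j => g.symm (g i ⊔ g j)
      le_sup_left := fun i j => by simp
      le_sup_right := fun i j => by simp
      sup_le := fun i j k h h' => by simpa using ⟨h, h'⟩ }
  have hT : IsNondecreasingFor T := by
    refine ⟨fun a b c hab hbc => ?_, fun a b c hab hbc => ⟨fun h => ?_, fun h => ?_⟩⟩
    · change g b ≤ g (g.symm (g a ⊔ g c))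
      rw [g.apply_symm_apply]
      exact he.le_sup _ _ _ ((hg a b).2 hab) ((hg b c).2 hbc)
    · refine he.ne_sup_right _ _ _ ((hg' a b).2 hab) ((hg' b c).2 hbc) ?_
      exact g.eq_symm_apply.1 h
    · refine he.ne_sup_left _ _ _ ((hg' a b).2 hab) ((hg' b c).2 hbc) ?_
      exact g.eq_symm_apply.1 h
  exact ⟨⟨T, hT⟩, ⟨{ toEquiv := g, map_rel_iff' := Iff.rfl }⟩⟩

/-! ### Gluing two semilattices under a new top -/

section Glue

variable {A B C D : Type*} [SemilatticeSup A] [SemilatticeSup B] [SemilatticeSup C]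
  [SemilatticeSup D]

/-- The join in the disjoint union of `A` and `B` with a top added: two elements of the same
summand keep their join, and all other joins are the top. -/
def glueSup : WithTop (A ⊕ B) → WithTop (A ⊕ B) → WithTop (A ⊕ B)
  | some (.inl a), some (.inl a') => some (.inl (a ⊔ a'))
  | some (.inr b), some (.inr b') => some (.inr (b ⊔ b'))
  | _, _ => none

/-- The disjoint union of two semilattices with a top added. -/
instance glueSemilatticeSup : SemilatticeSup (WithTop (A ⊕ B)) where
  sup := glueSup
  le_sup_left x y := by
    rcases x with _ | a | b <;> rcases y with _ | a' | b' <;>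
      first
      | exact le_top
      | exact WithTop.coe_le_coe.2 (Sum.inl_le_inl_iff.2 le_sup_left)
      | exact WithTop.coe_le_coe.2 (Sum.inr_le_inr_iff.2 le_sup_left)
  le_sup_right x y := by
    rcases x with _ | a | b <;> rcases y with _ | a' | b' <;>
      first
      | exact le_top
      | exact WithTop.coe_le_coe.2 (Sum.inl_le_inl_iff.2 le_sup_right)
      | exact WithTop.coe_le_coe.2 (Sum.inr_le_inr_iff.2 le_sup_right)
  sup_le x y z hx hy := by
    rcases z with _ | c | d <;> rcases x with _ | a | b <;> rcases y with _ | a' | b' <;>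
      first
      | exact le_top
      | exact hx
      | exact hy
      | exact WithTop.coe_le_coe.2 (Sum.inl_le_inl_iff.2 (sup_le
          (Sum.inl_le_inl_iff.1 (WithTop.coe_le_coe.1 hx))
          (Sum.inl_le_inl_iff.1 (WithTop.coe_le_coe.1 hy))))
      | exact WithTop.coe_le_coe.2 (Sum.inr_le_inr_iff.2 (sup_le
          (Sum.inr_le_inr_iff.1 (WithTop.coe_le_coe.1 hx))
          (Sum.inr_le_inr_iff.1 (WithTop.coe_le_coe.1 hy))))
      | exact absurd (WithTop.coe_le_coe.1 hx) Sum.not_inl_le_inr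
      | exact absurd (WithTop.coe_le_coe.1 hx) Sum.not_inr_le_inl
      | exact absurd (WithTop.coe_le_coe.1 hy) Sum.not_inl_le_inr
      | exact absurd (WithTop.coe_le_coe.1 hy) Sum.not_inr_le_inl

/-- Labels for the glued semilattice: first the labels of `A`, which are below `k`, then `k` for
the top, then the labels of `B`, shifted by `k + 1`. -/
def glueLabel (k : ℕ) (e : A → ℕ) (e' : B → ℕ) : WithTop (A ⊕ B) → ℕ
  | none => k
  | some (.inl a) => e a
  | some (.inr b) => k + 1 + e' b

theorem IsNondecLabelling.glue {k : ℕ} {e : A → ℕ} {e' : B → ℕ} (he : IsNondecLabelling e)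
    (he' : IsNondecLabelling e') (hk : ∀ a, e a < k) : IsNondecLabelling (glueLabel k e e') where
  injective x y h := by
    rcases x with _ | a | b <;> rcases y with _ | a' | b' <;> simp only [glueLabel] at h
    · rfl
    · have := hk a'; omega
    · omega
    · have := hk a; omega
    · rw [he.injective h]
    · have := hk a; omega
    · omega
    · have := hk a'; omega
    · rw [he'.injective (Nat.add_left_cancel h)]
  le_sup x y z hxy hyz := by
    rcases x with _ | a | b <;> rcases z with _ | a'' | b'' <;> try exact le_top
    · rcases y with _ | a' | b' <;> simp only [glueLabel] at hxy hyz
      · have := hk a''; omega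
      · exact WithTop.coe_le_coe.2 (Sum.inl_le_inl_iff.2 (he.le_sup _ _ _ hxy hyz))
      · have := hk a''; omega
    · rcases y with _ | a' | b' <;> simp only [glueLabel] at hxy hyz
      · omega
      · have := hk a'; omega
      · exact WithTop.coe_le_coe.2 (Sum.inr_le_inr_iff.2
          (he'.le_sup _ _ _ (Nat.le_of_add_le_add_left hxy) (Nat.le_of_add_le_add_left hyz)))
  ne_sup_right x y z hxy hyz h := by
    rcases x with _ | a | b <;> rcases y with _ | a' | b' <;> rcases z with _ | a'' | b'' <;>
      simp only [glueLabel] at hxy hyz <;>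
      first
      | cases h; done
      | omega
      | exact absurd hxy (by have := hk a'; omega)
      | exact absurd hyz (by have := hk a''; omega)
      | exact he.ne_sup_right _ _ _ hxy hyz (Sum.inl_injective (Option.some_injective _ h))
      | exact he'.ne_sup_right _ _ _ (Nat.lt_of_add_lt_add_left hxy)
          (Nat.lt_of_add_lt_add_left hyz) (Sum.inr_injective (Option.some_injective _ h))
  ne_sup_left x y z hxy hyz h := by
    rcases x with _ | a | b <;> rcases y with _ | a' | b' <;> rcases z with _ | a'' | b'' <;>
      simp only [glueLabel] at hxy hyz <;>
      first
      | cases h; done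
      | omega
      | exact absurd hxy (by have := hk a'; omega)
      | exact absurd hyz (by have := hk a''; omega)
      | exact he.ne_sup_left _ _ _ hxy hyz (Sum.inl_injective (Option.some_injective _ h))
      | exact he'.ne_sup_left _ _ _ (Nat.lt_of_add_lt_add_left hxy)
          (Nat.lt_of_add_lt_add_left hyz) (Sum.inr_injective (Option.some_injective _ h))

/-! ### Isomorphisms between glued semilattices -/

/-- Comparable elements of a disjoint union lie in the same summand. -/
theorem isLeft_eq_of_le {x y : A ⊕ B} (h : x ≤ y) : x.isLeft = y.isLeft := by
  rcases h with ⟨_⟩ | ⟨_⟩ <;> rfl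

/-- The image of a semilattice in a disjoint union is connected, hence lies in one summand. -/
theorem forall_isLeft_or_forall_isRight (f : A → C ⊕ D) (hf : Monotone f) :
    (∀ a, (f a).isLeft) ∨ (∀ a, (f a).isRight) := by
  have key : ∀ a a', (f a).isLeft = (f a').isLeft := fun a a' =>
    (isLeft_eq_of_le (hf (le_sup_left : a ≤ a ⊔ a'))).trans
      (isLeft_eq_of_le (hf (le_sup_right : a' ≤ a ⊔ a'))).symm
  by_contra! h
  obtain ⟨⟨a, ha⟩, a', ha'⟩ := h
  have := key a a'
  cases h1 : f a <;> cases h2 : f a' <;> simp_all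

/-- An isomorphism of disjoint unions that preserves sides restricts to the left summands; it is
onto `C` because no element of `B` can be sent there. -/
theorem nonempty_orderIso_left (f : A ⊕ B ≃o C ⊕ D) (hA : ∀ a, (f (.inl a)).isLeft)
    (hB : ∀ b, (f (.inr b)).isRight) : Nonempty (A ≃o C) := by
  choose g hg using fun a => Sum.isLeft_iff.1 (hA a)
  have hle : ∀ a a', g a ≤ g a' ↔ a ≤ a' := fun a a' => by
    rw [← Sum.inl_le_inl_iff (β := D), ← hg, ← hg, f.le_iff_le, Sum.inl_le_inl_iff]
  refine ⟨RelIso.ofSurjective (OrderEmbedding.ofMapLEIff g hle) fun c => ?_⟩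
  obtain ⟨x, hx⟩ := f.surjective (.inl c)
  rcases x with a | b
  · exact ⟨a, Sum.inl_injective ((hg a).symm.trans hx)⟩
  · have := hB b
    simp [hx] at this

theorem nonempty_orderIso_of_sum (f : A ⊕ B ≃o C ⊕ D) (hA : ∀ a, (f (.inl a)).isLeft)
    (hB : ∀ b, (f (.inr b)).isRight) : Nonempty (A ≃o C) ∧ Nonempty (B ≃o D) :=
  ⟨nonempty_orderIso_left f hA hB,
    nonempty_orderIso_left ((OrderIso.sumComm B A).trans (f.trans (OrderIso.sumComm C D)))
      (fun b => (Sum.isLeft_swap _).trans (hB b)) (fun a => (Sum.isRight_swap _).trans (hA a))⟩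

/-- A disjoint union of two semilattices determines the summands up to order. -/
theorem nonempty_orderIso_or_of_sum (f : A ⊕ B ≃o C ⊕ D) :
    (Nonempty (A ≃o C) ∧ Nonempty (B ≃o D)) ∨ (Nonempty (A ≃o D) ∧ Nonempty (B ≃o C)) := by
  have straight := nonempty_orderIso_of_sum f
  have swapped : (∀ a, (f (.inl a)).isRight) → (∀ b, (f (.inr b)).isLeft) →
      Nonempty (A ≃o D) ∧ Nonempty (B ≃o C) := fun hA hB =>
    nonempty_orderIso_of_sum (f.trans (OrderIso.sumComm C D))
      (fun a => (Sum.isLeft_swap _).trans (hA a)) (fun b => (Sum.isRight_swap _).trans (hB b))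
  -- Elements of different summands have no common upper bound, so the images of two nonempty
  -- summands cannot lie in the same summand.
  have hne : ∀ a b, (f (.inl a)).isLeft ≠ (f (.inr b)).isLeft := by
    intro a b h
    obtain ⟨z, hz, hz'⟩ : ∃ z, f (.inl a) ≤ z ∧ f (.inr b) ≤ z := by
      rcases h1 : f (.inl a) with c | d <;> rcases h2 : f (.inr b) with c' | d'
      · exact ⟨.inl (c ⊔ c'), by simp, by simp⟩
      · simp [h1, h2] at h
      · simp [h1, h2] at h
      · exact ⟨.inr (d ⊔ d'), by simp, by simp⟩
    have h1 := isLeft_eq_of_le (f.le_symm_apply.2 hz)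
    have h2 := isLeft_eq_of_le (f.le_symm_apply.2 hz')
    simpa using h1.trans h2.symm
  rcases forall_isLeft_or_forall_isRight (fun a => f (.inl a))
      (f.monotone.comp Sum.inl_mono) with hA | hA <;>
    rcases forall_isLeft_or_forall_isRight (fun b => f (.inr b))
      (f.monotone.comp Sum.inr_mono) with hB | hB
  · rcases isEmpty_or_nonempty B with hB0 | ⟨⟨b⟩⟩
    · exact .inl (straight hA hB0.elim)
    · exact .inr (swapped (fun a => absurd ((hA a).trans (hB b).symm) (hne a b)) hB)
  · exact .inl (straight hA hB)
  · exact .inr (swapped hA hB)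
  · rcases isEmpty_or_nonempty B with hB0 | ⟨⟨b⟩⟩
    · exact .inr (swapped hA hB0.elim)
    · refine .inl (straight (fun a => absurd ?_ (hne a b)) hB)
      have h1 := hA a
      have h2 := hB b
      cases h3 : f (.inl a) <;> cases h4 : f (.inr b) <;> simp_all

/-- An isomorphism of orders with an added top restricts to the orders below the top. -/
theorem nonempty_orderIso_of_withTop {P Q : Type*} [PartialOrder P] [PartialOrder Q]
    (f : WithTop P ≃o WithTop Q) : Nonempty (P ≃o Q) := by
  let g : Option P ≃ Option Q := f.toEquiv
  have hg : g none = none := f.map_top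
  have key : ∀ p, some (Equiv.removeNone g p) = g (some p) := fun p =>
    Equiv.removeNone_some _ (Option.ne_none_iff_exists'.1 fun h =>
      Option.some_ne_none p (g.injective (h.trans hg.symm)))
  refine ⟨⟨Equiv.removeNone g, fun {p q} => ?_⟩⟩
  have h : f p ≤ f q ↔ (p : WithTop P) ≤ q := f.le_iff_le
  rw [WithTop.coe_le_coe] at h
  rw [← h, ← WithTop.coe_le_coe]
  exact iff_of_eq (congrArg₂ (fun x y : WithTop Q => x ≤ y) (key p) (key q))

end Glue

/-! ### Decomposition at the top -/

/-- A nondecreasing labelling restricts to the elements of a subset closed under joins. -/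
theorem IsNondecLabelling.subtype {P : Type*} [SemilatticeSup P] {e : P → ℕ}
    (he : IsNondecLabelling e) {p : P → Prop} (hp : ∀ ⦃x y⦄, p x → p y → p (x ⊔ y)) :
    letI := Subtype.semilatticeSup hp
    IsNondecLabelling fun x : {x // p x} => e x :=
  let := Subtype.semilatticeSup hp
  { injective := he.injective.comp Subtype.val_injective
    le_sup := fun a b c => he.le_sup a b c
    ne_sup_right := fun a b c hab hbc h =>
      he.ne_sup_right a b c hab hbc (congrArg Subtype.val h)
    ne_sup_left := fun a b c hab hbc h =>
      he.ne_sup_left a b c hab hbc (congrArg Subtype.val h) }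

/-- Every nonempty nondecreasing semilattice is glued from two smaller ones. The elements on
either side of the top are closed under joins, and by the convex-ideal property the join of
elements on different sides is the top. -/
theorem NondecSemilattice.exists_orderIso_glue {n : ℕ} (U : NondecSemilattice n) (hn : 0 < n) :
    ∃ k m, k + m + 1 = n ∧ ∃ (S : NondecSemilattice k) (T : NondecSemilattice m),
      Nonempty (U.Carrier ≃o WithTop (S.Carrier ⊕ T.Carrier)) := by
  have he := U.isNondecLabelling_pos
  obtain ⟨t, ht⟩ : ∃ t : U.Carrier, ∀ x, x ≤ t :=
    ⟨Finset.univ.sup' ⟨(⟨0, hn⟩ : Fin n), Finset.mem_univ _⟩ id,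
      fun x => Finset.le_sup' id (Finset.mem_univ x)⟩
  have hL : ∀ ⦃x y⦄, U.pos x < U.pos t → U.pos y < U.pos t → U.pos (x ⊔ y) < U.pos t := by
    intro x y hx hy
    by_contra! hz
    -- Otherwise `t` lies between `x` and `x ⊔ y` in the chain, so `t` is below `x ⊔ y`.
    have h : t = x ⊔ y := le_antisymm
      ((he.le_sup x t _ hx.le hz).trans (sup_le le_sup_left le_rfl)) (ht _)
    rcases lt_trichotomy (U.pos x) (U.pos y) with hxy | hxy | hxy
    · exact he.ne_sup_left _ _ _ hxy hy h
    · rw [he.injective hxy, sup_idem] at h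
      exact hy.ne (congrArg U.pos h.symm)
    · exact he.ne_sup_left _ _ _ hxy hx (h.trans (sup_comm _ _))
  have hR : ∀ ⦃x y⦄, U.pos t < U.pos x → U.pos t < U.pos y → U.pos t < U.pos (x ⊔ y) := by
    intro x y hx hy
    by_contra! hz
    have h : t = x ⊔ y := le_antisymm
      ((he.le_sup _ t x hz hx.le).trans (sup_le le_rfl le_sup_left)) (ht _)
    rcases lt_trichotomy (U.pos x) (U.pos y) with hxy | hxy | hxy
    · exact he.ne_sup_right _ _ _ hx hxy h
    · rw [he.injective hxy, sup_idem] at h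
      exact hy.ne (congrArg U.pos h)
    · exact he.ne_sup_right _ _ _ hy hxy (h.trans (sup_comm _ _))
  have hLR : ∀ x y, U.pos x < U.pos t → U.pos t < U.pos y → x ⊔ y = t := fun x y hx hy =>
    le_antisymm (ht _) (he.le_sup x t y hx.le hy.le)
  let := Subtype.semilatticeSup hL
  let := Subtype.semilatticeSup hR
  let g : WithTop ({x // U.pos x < U.pos t} ⊕ {x // U.pos t < U.pos x}) → U.Carrier
    | none => t
    | some (.inl x) => x
    | some (.inr x) => x
  have hg : ∀ x y, g x ≤ g y ↔ x ≤ y := by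
    rintro (_ | x | x) (_ | y | y)
    · exact iff_of_true le_rfl le_rfl
    · refine iff_of_false (fun h => ?_) (WithTop.not_top_le_coe _)
      exact y.2.ne (congrArg U.pos (le_antisymm (ht _) h))
    · refine iff_of_false (fun h => ?_) (WithTop.not_top_le_coe _)
      exact y.2.ne' (congrArg U.pos (le_antisymm (ht _) h))
    · exact iff_of_true (ht _) le_top
    · exact ⟨fun h => WithTop.coe_le_coe.2 (Sum.inl_le_inl_iff.2 h),
        fun h => (Sum.inl_le_inl_iff (a := x) (b := y)).1 (WithTop.coe_le_coe.1 h)⟩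
    · refine iff_of_false (fun h => ?_) fun h =>
        Sum.not_inl_le_inr (WithTop.coe_le_coe.1 h)
      exact y.2.ne (congrArg U.pos ((hLR _ _ x.2 y.2).symm.trans (sup_eq_right.2 h)))
    · exact iff_of_true (ht _) le_top
    · refine iff_of_false (fun h => ?_) fun h =>
        Sum.not_inr_le_inl (WithTop.coe_le_coe.1 h)
      exact y.2.ne' (congrArg U.pos ((hLR _ _ y.2 x.2).symm.trans (sup_eq_left.2 h)))
    · exact ⟨fun h => WithTop.coe_le_coe.2 (Sum.inr_le_inr_iff.2 h),
        fun h => (Sum.inr_le_inr_iff (a := x) (b := y)).1 (WithTop.coe_le_coe.1 h)⟩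
  have hsurj : Function.Surjective g := by
    intro x
    rcases lt_trichotomy (U.pos x) (U.pos t) with h | h | h
    · exact ⟨some (.inl ⟨x, h⟩), rfl⟩
    · exact ⟨none, (he.injective h).symm⟩
    · exact ⟨some (.inr ⟨x, h⟩), rfl⟩
  have f := RelIso.ofSurjective (OrderEmbedding.ofMapLEIff g hg) hsurj
  obtain ⟨S, ⟨eS⟩⟩ := (he.subtype hL).exists_orderIso rfl
  obtain ⟨T, ⟨eT⟩⟩ := (he.subtype hR).exists_orderIso rfl
  refine ⟨_, _, ?_, S, T,
    ⟨f.symm.trans (OrderIso.withTopCongr (OrderIso.sumCongr eS.symm eT.symm))⟩⟩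
  rw [← Fintype.card_sum, ← Fintype.card_option]
  exact (Fintype.card_congr f.toEquiv).trans U.card_carrier

theorem NondecSemilattice.exists_glue {k m n : ℕ} (h : k + m + 1 = n) (S : NondecSemilattice k)
    (T : NondecSemilattice m) :
    ∃ U : NondecSemilattice n, Nonempty (U.Carrier ≃o WithTop (S.Carrier ⊕ T.Carrier)) := by
  refine (S.isNondecLabelling_pos.glue T.isNondecLabelling_pos S.pos_lt).exists_orderIso ?_
  refine Fintype.card_option.trans ?_
  rw [Fintype.card_sum, S.card_carrier, T.card_carrier, h]

/-! ### Isomorphism types -/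

/-- The isomorphism types of nondecreasing semilattices with `n` elements. -/
def IsoType (n : ℕ) : Type := Quotient (nondecSemilatticeSetoid n)

namespace IsoType

/-- The isomorphism type of a nondecreasing semilattice. -/
def mk {n : ℕ} (S : NondecSemilattice n) : IsoType n := Quotient.mk _ S

variable {k m n : ℕ}

theorem mk_eq_mk {S T : NondecSemilattice n} : mk S = mk T ↔ Nonempty (S.Carrier ≃o T.Carrier) :=
  Quotient.eq (r := nondecSemilatticeSetoid n)

theorem mk_surjective : Function.Surjective (mk (n := n)) := Quotient.mk_surjective

instance : Finite (NondecSemilattice n) :=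
  Finite.of_injective (fun S x y => S.1.le x y : _ → Fin n → Fin n → Prop) fun _ _ h =>
    Subtype.ext (SemilatticeSup.ext fun x y => iff_of_eq (congrFun₂ h x y))

instance : Finite (IsoType n) := Finite.of_surjective mk mk_surjective

/-- The isomorphism type of the disjoint union, with a top added, of two semilattices of the given
types. -/
noncomputable def glue (h : k + m + 1 = n) : IsoType k → IsoType m → IsoType n :=
  Quotient.lift₂ (fun S T => mk (S.exists_glue h T).choose) fun S T S' T' hS hT => by
    obtain ⟨e⟩ : Nonempty (S.Carrier ≃o S'.Carrier) := hS
    obtain ⟨e'⟩ : Nonempty (T.Carrier ≃o T'.Carrier) := hT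
    obtain ⟨f⟩ := (S.exists_glue h T).choose_spec
    obtain ⟨f'⟩ := (S'.exists_glue h T').choose_spec
    exact mk_eq_mk.2
      ⟨f.trans ((OrderIso.withTopCongr (OrderIso.sumCongr e e')).trans f'.symm)⟩

theorem mk_eq_glue {h : k + m + 1 = n} {S : NondecSemilattice k} {T : NondecSemilattice m}
    {U : NondecSemilattice n} :
    mk U = glue h (mk S) (mk T) ↔ Nonempty (U.Carrier ≃o WithTop (S.Carrier ⊕ T.Carrier)) := by
  obtain ⟨f⟩ := (S.exists_glue h T).choose_spec
  exact mk_eq_mk.trans ⟨fun ⟨g⟩ => ⟨g.trans f⟩, fun ⟨g⟩ => ⟨g.trans f.symm⟩⟩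

theorem glue_comm (h : k + m + 1 = n) (h' : m + k + 1 = n) (a : IsoType k) (b : IsoType m) :
    glue h a b = glue h' b a := by
  obtain ⟨S, rfl⟩ := mk_surjective a
  obtain ⟨T, rfl⟩ := mk_surjective b
  obtain ⟨U, hU⟩ := mk_surjective (glue h (mk S) (mk T))
  obtain ⟨f⟩ := mk_eq_glue.1 hU
  rw [← hU, mk_eq_glue]
  exact ⟨f.trans (OrderIso.withTopCongr (OrderIso.sumComm _ _))⟩

theorem exists_eq_glue (hn : 0 < n) (a : IsoType n) :
    ∃ (k m : ℕ) (h : k + m + 1 = n) (b : IsoType k) (c : IsoType m), a = glue h b c := by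
  obtain ⟨U, rfl⟩ := mk_surjective a
  obtain ⟨k, m, h, S, T, e⟩ := U.exists_orderIso_glue hn
  exact ⟨k, m, h, mk S, mk T, mk_eq_glue.2 e⟩

/-- Two isomorphism types, of possibly different sizes, agree. Equality in the sigma type records
the equality of sizes. -/
theorem sigma_mk_eq_of_orderIso {S : NondecSemilattice k} {T : NondecSemilattice m}
    (e : Nonempty (S.Carrier ≃o T.Carrier)) :
    (⟨k, mk S⟩ : Σ i, IsoType i) = ⟨m, mk T⟩ := by
  obtain ⟨f⟩ := e
  obtain rfl : k = m := by
    rw [← S.card_carrier, ← T.card_carrier]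
    exact Fintype.card_congr f.toEquiv
  rw [mk_eq_mk.2 ⟨f⟩]

/-- A glued isomorphism type determines its two parts up to order. -/
theorem eq_or_eq_of_glue_eq_glue {k' m' : ℕ} {h : k + m + 1 = n} {h' : k' + m' + 1 = n}
    {a : IsoType k} {b : IsoType m} {c : IsoType k'} {d : IsoType m'}
    (heq : glue h a b = glue h' c d) :
    ((⟨k, a⟩ : Σ i, IsoType i) = ⟨k', c⟩ ∧ (⟨m, b⟩ : Σ i, IsoType i) = ⟨m', d⟩) ∨
      ((⟨k, a⟩ : Σ i, IsoType i) = ⟨m', d⟩ ∧ (⟨m, b⟩ : Σ i, IsoType i) = ⟨k', c⟩) := by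
  obtain ⟨S, rfl⟩ := mk_surjective a
  obtain ⟨T, rfl⟩ := mk_surjective b
  obtain ⟨S', rfl⟩ := mk_surjective c
  obtain ⟨T', rfl⟩ := mk_surjective d
  obtain ⟨U, hU⟩ := mk_surjective (glue h (mk S) (mk T))
  obtain ⟨f⟩ := mk_eq_glue.1 hU
  obtain ⟨f'⟩ := mk_eq_glue.1 (hU.trans heq)
  obtain ⟨g⟩ := nonempty_orderIso_of_withTop (f.symm.trans f')
  exact (nonempty_orderIso_or_of_sum g).imp
    (And.imp sigma_mk_eq_of_orderIso sigma_mk_eq_of_orderIso)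
    (And.imp sigma_mk_eq_of_orderIso sigma_mk_eq_of_orderIso)

/-! ### Counting -/

/-- Gluing a type with `i < n` elements to one with `N - 1 - i` elements. -/
noncomputable def glueSigma {n N : ℕ} (hN : 2 * n ≤ N)
    (x : Σ i : Fin n, IsoType i × IsoType (N - 1 - i)) : IsoType N :=
  glue (by have := x.1.2; omega) x.2.1 x.2.2

/-- As the first part is strictly smaller than the second one, the two cannot be swapped. -/
theorem glueSigma_injective {n N : ℕ} (hN : 2 * n ≤ N) : Function.Injective (glueSigma hN) := by
  rintro ⟨i, a, b⟩ ⟨j, c, d⟩ h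
  have hi := i.2
  have hj := j.2
  rcases eq_or_eq_of_glue_eq_glue h with ⟨h1, h2⟩ | ⟨h1, h2⟩
  · obtain rfl : i = j := Fin.ext (congrArg Sigma.fst h1)
    obtain rfl : a = c := sigma_mk_injective h1
    obtain rfl : b = d := sigma_mk_injective h2
    rfl
  · have := congrArg Sigma.fst h1
    dsimp only at this
    omega

theorem glue_mem_range_glueSigma {n N : ℕ} (hN : 2 * n ≤ N) (h : k + m + 1 = N) (hk : k < n)
    (a : IsoType k) (b : IsoType m) : glue h a b ∈ Set.range (glueSigma hN) := by
  obtain rfl : m = N - 1 - k := by omega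
  exact ⟨⟨⟨k, hk⟩, a, b⟩, rfl⟩

theorem card_sigma (n N : ℕ) : Nat.card (Σ i : Fin n, IsoType i × IsoType (N - 1 - i)) =
    ∑ i ∈ Finset.range n, numTypes i * numTypes (N - 1 - i) := by
  rw [Nat.card_sigma, Finset.sum_range]
  exact Finset.sum_congr rfl fun i _ => Nat.card_prod _ _

theorem numTypes_two_mul (n : ℕ) (hn : 1 ≤ n) :
    numTypes (2 * n) = ∑ i ∈ Finset.range n, numTypes i * numTypes (2 * n - 1 - i) := by
  rw [← card_sigma]
  refine (Nat.card_congr (Equiv.ofBijective _ ⟨glueSigma_injective le_rfl, fun a => ?_⟩)).symm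
  obtain ⟨k, m, h, b, c, rfl⟩ := exists_eq_glue (by omega) a
  rcases lt_or_ge k n with hk | hk
  · exact glue_mem_range_glueSigma _ h hk b c
  · rw [glue_comm h (by omega)]
    exact glue_mem_range_glueSigma _ _ (by omega) c b

/-- Gluing an unordered pair of types of the same size. -/
noncomputable def glueSym2 (n : ℕ) : Sym2 (IsoType n) → IsoType (2 * n + 1) :=
  Sym2.lift ⟨glue (by omega), fun a b => glue_comm _ _ a b⟩

theorem glueSym2_injective (n : ℕ) : Function.Injective (glueSym2 n) := by
  intro x y
  induction x, y using Sym2.inductionOn₂ with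
  | _ a b c d =>
    intro h
    have hn : n + n + 1 = 2 * n + 1 := by omega
    refine Sym2.eq_iff.2 ((eq_or_eq_of_glue_eq_glue (h := hn) (h' := hn) h).imp ?_ ?_) <;>
      exact And.imp (fun h => sigma_mk_injective h) (fun h => sigma_mk_injective h)

theorem glueSigma_ne_glueSym2 {n : ℕ} (hN : 2 * n ≤ 2 * n + 1)
    (x : Σ i : Fin n, IsoType i × IsoType (2 * n + 1 - 1 - i)) (y : Sym2 (IsoType n)) :
    glueSigma hN x ≠ glueSym2 n y := by
  induction y using Sym2.inductionOn with
  | _ c d =>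
    intro h
    have hx := x.1.2
    have hn : n + n + 1 = 2 * n + 1 := by omega
    rcases eq_or_eq_of_glue_eq_glue (h' := hn) h with ⟨h1, -⟩ | ⟨h1, -⟩ <;>
    · have := congrArg Sigma.fst h1
      dsimp only at this
      omega

theorem numTypes_two_mul_add_one (n : ℕ) :
    numTypes (2 * n + 1) = ∑ i ∈ Finset.range n, numTypes i * numTypes (2 * n - i) +
      (numTypes n + 1).choose 2 := by
  have hN : 2 * n ≤ 2 * n + 1 := Nat.le_succ _
  have hsym : Nat.card (Sym2 (IsoType n)) = (numTypes n + 1).choose 2 := by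
    have := Fintype.ofFinite (IsoType n)
    classical
    rw [Nat.card_eq_fintype_card, Sym2.card, ← Nat.card_eq_fintype_card]
    rfl
  rw [← hsym]
  refine Eq.trans (Nat.card_congr (Equiv.ofBijective (Sum.elim (glueSigma hN) (glueSym2 n))
    ⟨(glueSigma_injective hN).sumElim (glueSym2_injective n) (glueSigma_ne_glueSym2 hN),
      fun a => ?_⟩)).symm (Nat.card_sum.trans (congrArg (· + _) (card_sigma n (2 * n + 1))))
  rw [← Set.mem_range, Set.Sum.elim_range]
  obtain ⟨k, m, h, b, c, rfl⟩ := exists_eq_glue (by omega) a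
  rcases lt_trichotomy k n with hk | rfl | hk
  · exact .inl (glue_mem_range_glueSigma _ h hk b c)
  · obtain rfl : m = k := by omega
    exact .inr ⟨s(b, c), rfl⟩
  · rw [glue_comm h (by omega)]
    exact .inl (glue_mem_range_glueSigma _ _ (by omega) c b)

end IsoType

theorem numTypes_zero : numTypes 0 = 1 := by
  refine Nat.card_eq_one_iff_unique.2 ⟨⟨fun a b => ?_⟩, ⟨IsoType.mk
    ⟨inferInstance, fun a => a.elim0, fun a => a.elim0⟩⟩⟩
  obtain ⟨S, rfl⟩ := IsoType.mk_surjective a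
  obtain ⟨T, rfl⟩ := IsoType.mk_surjective b
  exact IsoType.mk_eq_mk.2 ⟨⟨Equiv.refl (Fin 0), fun {x} => Fin.elim0 x⟩⟩

theorem mainTheorem8 :
    numTypes 0 = 1 ∧ numTypes 1 = 1 ∧
    ∀ n : ℕ, 1 ≤ n →
      numTypes (2 * n) = ∑ i ∈ Finset.range n, numTypes i * numTypes (2 * n - 1 - i) ∧
      (numTypes (2 * n + 1) : ℚ) =
        ∑ i ∈ Finset.range n, (numTypes i : ℚ) * (numTypes (2 * n - i) : ℚ) +
          (numTypes n : ℚ) / 2 * ((numTypes n : ℚ) + 1) := by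
  refine ⟨numTypes_zero, ?_, fun n hn => ⟨IsoType.numTypes_two_mul n hn, ?_⟩⟩
  · -- The odd recurrence at `n = 0` has an empty sum.
    simpa [numTypes_zero] using IsoType.numTypes_two_mul_add_one 0
  · rw [IsoType.numTypes_two_mul_add_one, Nat.cast_add, Nat.cast_choose_two]
    push_cast
    ring
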